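/- A function $f:\mathbb R^n\to\mathbb R$ is called quadratic if $f(x)=\tfrac12 x^{\mathsf T}Ax+b^{\mathsf T}x+c$ with $A=A^{\mathsf T}\in\mathbb R^{n\times n}$, $b\in\mathbb R^n$, $c\in\mathbb R$. A set $F\subset\mathbb R^n$ is a Frank-and-Wolfe set (FW-set) if every quadratic function which is bounded below on $F$ attains its infimum on $F$. A closed set $F\subset\mathbb R^n$ is a Motzkin set if $F=K+D$ with $K\subset\mathbb R^n$ compact (not necessarily convex) and $D\subset\mathbb R^n$ a closed convex cone (containing $0$). A Motzkin Frank-and-Wolfe set (FWM-set) is a Motzkin set which is also an FW-set. Proposition. Let $T:\mathbb R^n\to\mathbb R^m$ be an affine mapping and let $F\subset\mathbb R^m$ be an FWM-set. If the pre-image $T^{-1}(F)\subset\mathbb R^n$ is nonempty, then $T^{-1}(F)$ is an FWM-set. -/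

import Mathlib

open scoped Pointwise Matrix

namespace FrankWolfe

/-- Quadratic functions on `ℝⁿ`: `f x = ½ xᵀ A x + bᵀ x + c` with `A` symmetric
(`A = 0` is allowed, so affine functions are included). -/
def IsQuadratic {n : ℕ} (f : EuclideanSpace ℝ (Fin n) → ℝ) : Prop :=
  ∃ (A : Matrix (Fin n) (Fin n) ℝ) (b : Fin n → ℝ) (c : ℝ), A.IsSymm ∧
    ∀ x : EuclideanSpace ℝ (Fin n),
      f x = (1 / 2 : ℝ) * (x.ofLp ⬝ᵥ (A *ᵥ x.ofLp)) + b ⬝ᵥ x.ofLp + c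

/-- Frank-and-Wolfe sets: every quadratic function that is bounded below on `F`
attains its infimum over `F` at a point of `F`. -/
def IsFWSet {n : ℕ} (F : Set (EuclideanSpace ℝ (Fin n))) : Prop :=
  ∀ f : EuclideanSpace ℝ (Fin n) → ℝ, IsQuadratic f → BddBelow (f '' F) →
    ∃ x ∈ F, IsMinOn f F x

/-- Motzkin sets: closed sets of the form `K + D` with `K` compact (not necessarily convex)
and `D` a closed convex cone (a `ProperCone` is a closed convex cone containing `0`). -/
def IsMotzkinSet {n : ℕ} (F : Set (EuclideanSpace ℝ (Fin n))) : Prop :=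
  IsClosed F ∧ ∃ (K : Set (EuclideanSpace ℝ (Fin n)))
    (D : ProperCone ℝ (EuclideanSpace ℝ (Fin n))),
      IsCompact K ∧ F = K + (D : Set (EuclideanSpace ℝ (Fin n)))

/-- FWM-sets: Motzkin sets that are Frank-and-Wolfe sets. -/
def IsFWMSet {n : ℕ} (F : Set (EuclideanSpace ℝ (Fin n))) : Prop :=
  IsMotzkinSet F ∧ IsFWSet F

end FrankWolfe

/-! ### Cones whose sums with subspaces are closed (Mirkil) -/

namespace FrankWolfe

section

open Filter Topology RealInnerProductSpace


variable {V : Type*} [NormedAddCommGroup V] [InnerProductSpace ℝ V]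

/-! Write `F = K + D`. The FW property, applied to squared distances modulo a subspace `W`, makes `F
+ W` closed. Cancelling the compact set `K` (`mem_of_forall_add_mem_add`) makes every `D + W`
closed, and Mirkil's argument then shows that `D` is polyhedral near each of its points `v`: members
of `D` close to `v` remain in `D` after subtracting `v / 2`.

This local property passes to preimages under an affine map with linear part `L` as retractivity
along `L⁻¹(D)`: a sequence escaping in direction `v` eventually stays in the set after a step `-v`,
and such a step shortens it. Retractivity yields both conclusions by minimal-norm arguments:
norm-minimal representatives modulo the cone are bounded (Motzkin), and norm-minimal points of
sublevel sets of a quadratic cannot escape to infinity (Frank–Wolfe). -/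

lemma exists_norm_minimal [FiniteDimensional ℝ V] {S : Set V} (hS : IsClosed S) (hne : S.Nonempty) :
    ∃ x ∈ S, ∀ y ∈ S, ‖x‖ ≤ ‖y‖ := by
  have : ProperSpace V := FiniteDimensional.proper ℝ V
  obtain ⟨x, hx, h⟩ := hS.exists_infDist_eq_dist hne 0
  refine ⟨x, hx, fun y hy => ?_⟩
  have := Metric.infDist_le_dist_of_mem (x := (0 : V)) hy
  rwa [h, dist_zero_left, dist_zero_left] at this

/-- A linear map is bounded below on the nonnegative orthant up to changing the representative. -/
lemma exists_bounded_nonneg_preimage {ι : Type*} [Fintype ι] (A : EuclideanSpace ℝ ι →L[ℝ] V) :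
    ∃ M : ℝ, ∀ x : EuclideanSpace ℝ ι, (∀ i, 0 ≤ x i) →
      ∃ y : EuclideanSpace ℝ ι, (∀ i, 0 ≤ y i) ∧ A y = A x ∧ ‖y‖ ≤ M * ‖A x‖ := by
  by_contra! H
  choose x hx hH using fun n : ℕ => H (n + 1)
  have hmin : ∀ n, ∃ y ∈ {y : EuclideanSpace ℝ ι | (∀ i, 0 ≤ y i) ∧ A y = A (x n)},
      ∀ z ∈ {y : EuclideanSpace ℝ ι | (∀ i, 0 ≤ y i) ∧ A y = A (x n)}, ‖y‖ ≤ ‖z‖ := by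
    intro n
    refine exists_norm_minimal ?_ ⟨x n, hx n, rfl⟩
    refine IsClosed.inter (s₁ := {y | ∀ i, 0 ≤ y i}) ?_ (isClosed_eq A.continuous continuous_const)
    simp only [Set.ofPred_forall]
    exact isClosed_iInter fun i => isClosed_le continuous_const (by fun_prop)
  choose y hy hymin using hmin
  have hypos : ∀ n, 0 < ‖y n‖ := fun n =>
    lt_of_le_of_lt (by positivity) (hH n (y n) (hy n).1 (hy n).2)
  obtain ⟨u, hu, φ, hφ, hlim⟩ := (isCompact_sphere (0 : EuclideanSpace ℝ ι) 1).tendsto_subseq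
    (x := fun n => ‖y n‖⁻¹ • y n) (fun n => by
      simp [norm_smul, (hypos n).ne'])
  have hu1 : ‖u‖ = 1 := by simpa using hu
  have hcoord : ∀ i, Tendsto (fun n => ‖y (φ n)‖⁻¹ * y (φ n) i) atTop (𝓝 (u i)) := fun i =>
    ((EuclideanSpace.proj (𝕜 := ℝ) i).continuous.tendsto u).comp hlim
  have hu0 : ∀ i, 0 ≤ u i := fun i => ge_of_tendsto' (hcoord i) fun n =>
    mul_nonneg (inv_nonneg.2 (norm_nonneg _)) ((hy _).1 i)
  have hAu : A u = 0 := by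
    have h1 : Tendsto (fun n => A (‖y (φ n)‖⁻¹ • y (φ n))) atTop (𝓝 (A u)) :=
      (A.continuous.tendsto u).comp hlim
    refine tendsto_nhds_unique h1 (squeeze_zero_norm (fun n => ?_)
      ((tendsto_one_div_add_atTop_nhds_zero_nat (𝕜 := ℝ)).comp hφ.tendsto_atTop))
    have h2 := hH (φ n) (y (φ n)) (hy _).1 (hy _).2
    rw [map_smul, (hy _).2, norm_smul, norm_inv, norm_norm, Function.comp_apply,
      inv_mul_eq_div, div_le_div_iff₀ (hypos _) (by positivity)]
    linarith
  -- Half of the kernel vector `u` can be removed: coordinates with `u i = 0` are unaffected, the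
  -- others converge to `u i > u i / 2`. The result is a shorter nonnegative preimage, contradicting
  -- minimality.
  have hev1 : ∀ᶠ n in atTop, ∀ i, 0 ≤ ‖y (φ n)‖⁻¹ * y (φ n) i - u i / 2 := by
    rw [eventually_all]
    intro i
    rcases (hu0 i).eq_or_lt with h | h
    · filter_upwards with n
      rw [← h]
      have := mul_nonneg (inv_nonneg.2 (norm_nonneg (y (φ n)))) ((hy (φ n)).1 i)
      simpa using this
    · filter_upwards [(hcoord i).eventually (lt_mem_nhds (half_lt_self h))] with n hn
      linarith
  have hev2 : ∀ᶠ n in atTop, ‖‖y (φ n)‖⁻¹ • y (φ n) - (1 / 2 : ℝ) • u‖ < 1 := by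
    have : Tendsto (fun n => ‖‖y (φ n)‖⁻¹ • y (φ n) - (1 / 2 : ℝ) • u‖) atTop
        (𝓝 ‖u - (1 / 2 : ℝ) • u‖) := (hlim.sub_const _).norm
    refine this.eventually (gt_mem_nhds ?_)
    rw [show u - (1 / 2 : ℝ) • u = (1 / 2 : ℝ) • u by module, norm_smul, hu1]
    norm_num
  obtain ⟨n, h1, h2⟩ := (hev1.and hev2).exists
  have hp := hypos (φ n)
  have hz : y (φ n) - (‖y (φ n)‖ / 2) • u
      = ‖y (φ n)‖ • (‖y (φ n)‖⁻¹ • y (φ n) - (1 / 2 : ℝ) • u) := by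
    rw [smul_sub, smul_inv_smul₀ hp.ne', smul_smul]; ring_nf
  have := hymin (φ n) (y (φ n) - (‖y (φ n)‖ / 2) • u) ⟨fun i => by
      rw [hz]; exact mul_nonneg hp.le (by
        have := h1 i
        change 0 ≤ ‖y (φ n)‖⁻¹ * y (φ n) i - 1 / 2 * u i
        linarith), by
      rw [map_sub, map_smul, hAu, smul_zero, sub_zero, (hy _).2]⟩
  rw [hz, norm_smul, norm_norm] at this
  nlinarith

lemma fg_ofSubmodule [FiniteDimensional ℝ V] (W : Submodule ℝ V) : (PointedCone.ofSubmodule W).FG := by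
  have : Module.Finite {c : ℝ // 0 ≤ c} ℝ := by
    refine ⟨⟨{1, -1}, ?_⟩⟩
    rw [eq_top_iff]
    intro x _
    rcases le_total 0 x with h | h
    · have := Submodule.smul_mem (Submodule.span {c : ℝ // 0 ≤ c} ((({1, -1} : Finset ℝ)) : Set ℝ))
        ⟨x, h⟩ (Submodule.subset_span (by simp : (1 : ℝ) ∈ _))
      rwa [show (⟨x, h⟩ : {c : ℝ // 0 ≤ c}) • (1 : ℝ) = x from mul_one x] at this
    · have := Submodule.smul_mem (Submodule.span {c : ℝ // 0 ≤ c} ((({1, -1} : Finset ℝ)) : Set ℝ))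
        ⟨-x, neg_nonneg.2 h⟩ (Submodule.subset_span (by simp : (-1 : ℝ) ∈ _))
      rwa [show (⟨-x, neg_nonneg.2 h⟩ : {c : ℝ // 0 ≤ c}) • (-1 : ℝ) = x from
        by change -x * -1 = x; ring] at this
  exact (IsNoetherian.noetherian W).restrictScalars

/-- If a convex cone becomes finitely generated after adding the line through one of its points
`v`, then it is finitely generated near `v`. -/
lemma exists_fg_near {E : PointedCone ℝ V} {v : V} (hv : v ∈ E)
    (hfg : (E ⊔ PointedCone.ofSubmodule (ℝ ∙ v)).FG) :
    ∃ G : PointedCone ℝ V, G.FG ∧ G ≤ E ∧ v ∈ G ∧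
      ∃ δ > 0, ∀ w ∈ E, ‖w - v‖ < δ → w - (1 / 2 : ℝ) • v ∈ G := by
  obtain ⟨S, hS⟩ := hfg
  have hdec : ∀ g : S, ∃ e ∈ E, ∃ s : ℝ, e + s • v = g := by
    intro g
    have hg : (g : V) ∈ E ⊔ PointedCone.ofSubmodule (ℝ ∙ v) := hS ▸ Submodule.subset_span g.2
    obtain ⟨e, he, z, hz, h⟩ := Submodule.mem_sup.1 hg
    obtain ⟨s, rfl⟩ := Submodule.mem_span_singleton.1 ((PointedCone.mem_ofSubmodule_iff).1 hz)
    exact ⟨e, he, s, h⟩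
  choose e he s hes using hdec
  -- `A` evaluates a combination of the generators `g = e g + s g • v`; `N` collects its total
  -- coefficient of `v`. The radius below forces `|N y| ≤ 1 / 2`, so `1 / 2 + N y ≥ 0`.
  let A : EuclideanSpace ℝ S →L[ℝ] V := ∑ g : S, (EuclideanSpace.proj g).smulRight (g : V)
  have hA : ∀ x, A x = ∑ g : S, x g • (g : V) := fun x => by simp [A]
  let N : EuclideanSpace ℝ S →L[ℝ] ℝ := ∑ g : S, (EuclideanSpace.proj g).smulRight (s g)
  have hN : ∀ x, N x = ∑ g : S, x g * s g := fun x => by simp [N]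
  obtain ⟨M, hM⟩ := exists_bounded_nonneg_preimage A
  let G : PointedCone ℝ V := Submodule.span {c : ℝ // 0 ≤ c} (insert v (Set.range e))
  have hvG : v ∈ G := Submodule.subset_span (Set.mem_insert _ _)
  refine ⟨G, Submodule.fg_span ((Set.finite_range e).insert v), ?_, hvG,
    1 / (2 * (‖N‖ * |M| + 1)), by positivity, ?_⟩
  · refine Submodule.span_le.2 (Set.insert_subset hv ?_)
    rintro _ ⟨g, rfl⟩
    exact he g
  intro w hw hlt
  have hmem : w - v ∈ Submodule.span {c : ℝ // 0 ≤ c} (Set.range fun g : S => (g : V)) := by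
    have : w - v ∈ E ⊔ PointedCone.ofSubmodule (ℝ ∙ v) := by
      rw [sub_eq_add_neg]
      exact Submodule.add_mem_sup hw
        (PointedCone.mem_ofSubmodule_iff.2 (neg_mem (Submodule.mem_span_singleton_self v)))
    rw [← hS] at this
    simpa using this
  obtain ⟨c, hc⟩ := (Submodule.mem_span_range_iff_exists_fun {c : ℝ // 0 ≤ c}).1 hmem
  obtain ⟨y, hy0, hyA, hyM⟩ := hM (WithLp.toLp 2 fun g => (c g : ℝ)) fun g => (c g).2
  have hAx : A (WithLp.toLp 2 fun g => (c g : ℝ)) = w - v := by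
    rw [hA, ← hc]; rfl
  rw [hAx] at hyA hyM
  have hwv : w - v = ∑ g : S, y g • e g + N y • v := by
    rw [← hyA, hA, hN, Finset.sum_smul, ← Finset.sum_add_distrib]
    refine Finset.sum_congr rfl fun g _ => ?_
    rw [← hes g]; module
  have hNy : -(1 / 2) ≤ N y := by
    have h1 : ‖N y‖ ≤ ‖N‖ * (|M| * ‖w - v‖) := (N.le_opNorm y).trans (by
      gcongr; exact hyM.trans (by gcongr; exact le_abs_self M))
    have h2 : ‖N‖ * (|M| * ‖w - v‖) ≤ 1 / 2 := by
      rw [lt_div_iff₀ (by positivity)] at hlt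
      nlinarith [norm_nonneg (w - v)]
    have := neg_le_of_abs_le (h1.trans h2)
    linarith
  rw [show w - (1 / 2 : ℝ) • v = ∑ g : S, y g • e g + (1 / 2 + N y) • v by
    rw [show w = (w - v) + v by abel, hwv]; module]
  refine add_mem (sum_mem fun g _ => ?_) (G.smul_mem (by linarith) hvG)
  exact G.smul_mem (hy0 g) (Submodule.subset_span (Set.mem_insert_of_mem _ ⟨g, rfl⟩))

variable [FiniteDimensional ℝ V]

/-- Mirkil's theorem: a convex cone all of whose linear images are closed is polyhedral. -/
theorem fg_of_isClosed_sup {C : PointedCone ℝ V}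
    (hC : ∀ W : Submodule ℝ V, IsClosed ((C ⊔ PointedCone.ofSubmodule W : PointedCone ℝ V) : Set V))
    (W : Submodule ℝ V) : (C ⊔ PointedCone.ofSubmodule W).FG := by
  have : ProperSpace V := FiniteDimensional.proper ℝ V
  -- Downward induction: a unit `v ∈ Wᗮ` enlarges `W`, so the cone is finitely generated near `v`;
  -- compactness of the unit vectors of `E` in `Wᗮ` leaves finitely many such pieces.
  induction W using WellFoundedGT.induction with
  | ind W ih =>
  set E : PointedCone ℝ V := C ⊔ PointedCone.ofSubmodule W with hE
  have hWE : PointedCone.ofSubmodule W ≤ E := le_sup_right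
  have hcomp : IsCompact ((E : Set V) ∩ (Wᗮ : Set V) ∩ Metric.sphere 0 1) :=
    (isCompact_sphere 0 1).inter_left ((hC W).inter Wᗮ.closed_of_finiteDimensional)
  obtain ⟨G, hG, hGE, hsub⟩ : ∃ G : PointedCone ℝ V, G.FG ∧ G ≤ E ∧
      (E : Set V) ∩ (Wᗮ : Set V) ∩ Metric.sphere 0 1 ⊆ G := by
    refine hcomp.induction_on (p := fun s => ∃ G : PointedCone ℝ V, G.FG ∧ G ≤ E ∧ s ⊆ G)
      ⟨⊥, Submodule.fg_bot, bot_le, Set.empty_subset _⟩ ?_ ?_ ?_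
    · rintro s t hst ⟨G, h1, h2, h3⟩
      exact ⟨G, h1, h2, hst.trans h3⟩
    · rintro s t ⟨G, h1, h2, h3⟩ ⟨G', h1', h2', h3'⟩
      exact ⟨G ⊔ G', h1.sup h1', sup_le h2 h2', Set.union_subset
        (h3.trans fun _ h => Submodule.mem_sup_left h)
        (h3'.trans fun _ h => Submodule.mem_sup_right h)⟩
    · rintro v ⟨⟨hvE, hvW⟩, hv1⟩
      have hlt : W < W ⊔ ℝ ∙ v := by
        refine lt_of_le_of_ne le_sup_left fun h => ?_
        have hv : v ∈ W := by
          rw [h]; exact Submodule.mem_sup_right (Submodule.mem_span_singleton_self v)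
        have : v = 0 := by
          have := Submodule.inner_right_of_mem_orthogonal hv hvW
          exact inner_self_eq_zero.1 this
        simp [this] at hv1
      have hfg := ih _ hlt
      rw [PointedCone.ofSubmodule_sup, ← sup_assoc] at hfg
      obtain ⟨G, hG, hGE, hvG, δ, hδ, h⟩ := exists_fg_near hvE hfg
      refine ⟨(E : Set V) ∩ Metric.ball v δ, ?_, G, hG, hGE, ?_⟩
      · exact inter_mem (mem_of_superset self_mem_nhdsWithin fun x hx => hx.1.1)
          (mem_nhdsWithin_of_mem_nhds (Metric.ball_mem_nhds v hδ))
      · rintro w ⟨hw, hwv⟩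
        have := add_mem (h w hw (by simpa [dist_eq_norm] using hwv))
          (G.smul_mem (r := (1 / 2 : ℝ)) (by norm_num) hvG)
        simpa using this
  have hEG : E = G ⊔ PointedCone.ofSubmodule W := by
    refine le_antisymm (fun x hx => ?_) (sup_le hGE hWE)
    obtain ⟨p, hp, r, hr, rfl⟩ := W.exists_add_mem_mem_orthogonal x
    rw [add_comm]
    refine Submodule.add_mem_sup ?_ hp
    have hrE : r ∈ E := by
      have := add_mem hx (hWE (PointedCone.mem_ofSubmodule_iff.2 (neg_mem hp)))
      simpa using this
    rcases eq_or_ne r 0 with rfl | h0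
    · exact zero_mem _
    have h1 := norm_pos_iff.2 h0
    have := G.smul_mem h1.le (hsub (a := ‖r‖⁻¹ • r)
      ⟨⟨E.smul_mem (inv_nonneg.2 h1.le) hrE, Wᗮ.smul_mem _ hr⟩, by simp [norm_smul, h1.ne']⟩)
    rwa [smul_inv_smul₀ h1.ne'] at this
  rw [hEG]
  exact hG.sup (fg_ofSubmodule W)

lemma exists_forall_sub_half_mem {C : PointedCone ℝ V}
    (hC : ∀ W : Submodule ℝ V, IsClosed ((C ⊔ PointedCone.ofSubmodule W : PointedCone ℝ V) : Set V))
    {v : V} (hv : v ∈ C) : ∃ δ > 0, ∀ w ∈ C, ‖w - v‖ < δ → w - (1 / 2 : ℝ) • v ∈ C := by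
  obtain ⟨G, -, hG, -, δ, hδ, h⟩ := exists_fg_near hv (fg_of_isClosed_sup hC _)
  exact ⟨δ, hδ, fun w hw hwv => hG (h w hw hwv)⟩

end

end FrankWolfe

/-! ### Cancellation of a compact summand; closedness from the FW property -/

namespace FrankWolfe

section

open Filter Topology RealInnerProductSpace


variable {V : Type*} [NormedAddCommGroup V] [InnerProductSpace ℝ V] [FiniteDimensional ℝ V]

/-- Proper separation of a point from a convex cone which need not be closed. -/
lemma exists_separating_functional {C : PointedCone ℝ V} {c : V} (hc : c ∉ C) :
    ∃ f : V →L[ℝ] ℝ, f c ≤ 0 ∧ (∀ x ∈ C, 0 ≤ f x) ∧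
      (f c < 0 ∨ ∃ x ∈ Submodule.span ℝ (C : Set V), f x ≠ 0) := by
  set U := Submodule.span ℝ (C : Set V)
  have hCU : ∀ x ∈ C, x ∈ U := fun x hx => Submodule.subset_span hx
  by_cases hcU : c ∈ U
  -- Adding `Uᗮ` gives the cone nonempty interior, so Hahn–Banach applies without closedness.
  · set C' : PointedCone ℝ V := C ⊔ PointedCone.ofSubmodule Uᗮ
    have hUC' : ∀ r ∈ Uᗮ, r ∈ C' := fun r hr => Submodule.mem_sup_right hr
    have hcC' : c ∉ C' := by
      intro h
      obtain ⟨a, ha, b, hb, rfl⟩ := Submodule.mem_sup.1 h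
      have hbU : b ∈ U := by simpa using U.sub_mem hcU (hCU a ha)
      have : b = 0 := inner_self_eq_zero.1 (Submodule.inner_right_of_mem_orthogonal hbU hb)
      exact hc (by simpa [this] using ha)
    have hspan : affineSpan ℝ (C' : Set V) = ⊤ := by
      refine (AffineSubspace.affineSpan_eq_top_iff_vectorSpan_eq_top_of_nonempty ℝ V V
        ⟨0, zero_mem _⟩).2 (eq_top_iff.2 fun x _ => ?_)
      have h0 : ∀ y ∈ C', y ∈ vectorSpan ℝ (C' : Set V) := fun y hy => by
        simpa using vsub_mem_vectorSpan ℝ (s := (C' : Set V)) hy (zero_mem C')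
      obtain ⟨p, hp, r, hr, rfl⟩ := U.exists_add_mem_mem_orthogonal x
      exact add_mem ((Submodule.span_le (p := vectorSpan ℝ (C' : Set V))).2
        (fun y hy => h0 y (Submodule.mem_sup_left hy)) hp) (h0 r (hUC' r hr))
    obtain ⟨f, u, hf0, hf, hu⟩ := geometric_hahn_banach_of_nonempty_interior C'.convex
      (convex_singleton c) (Set.disjoint_singleton_right.2 fun h => hcC' (interior_subset h))
      (C'.convex.interior_nonempty_iff_affineSpan_eq_top.2 hspan) (Set.singleton_nonempty c)
    have hu0 : 0 ≤ u := by simpa using hf 0 (zero_mem C')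
    have hneg : ∀ a ∈ C', f a ≤ 0 := by
      intro a ha
      by_contra! hpos
      have := hf (((u + 1) / f a) • a) (C'.smul_mem (by positivity) ha)
      rw [map_smul, smul_eq_mul, div_mul_cancel₀ _ hpos.ne'] at this
      linarith
    refine ⟨-f, by simpa using hu0.trans (hu c rfl),
      fun x hx => by simpa using hneg x (Submodule.mem_sup_left hx), Or.inr ?_⟩
    obtain ⟨x, hx⟩ : ∃ x, f x ≠ 0 := by
      by_contra! h
      exact hf0 (ContinuousLinearMap.ext h)
    obtain ⟨p, hp, r, hr, rfl⟩ := U.exists_add_mem_mem_orthogonal x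
    have h1 := hneg r (hUC' r hr)
    have h2 := hneg (-r) (hUC' _ (neg_mem hr))
    rw [map_neg] at h2
    have h3 : f r = 0 := by linarith
    refine ⟨p, hp, ?_⟩
    simpa [h3] using hx
  · obtain ⟨p, hp, r, hr, rfl⟩ := U.exists_add_mem_mem_orthogonal c
    have hr0 : r ≠ 0 := by
      rintro rfl
      exact hcU (by simpa using hp)
    have h1 : (-(innerSL ℝ r)) (p + r) < 0 := by
      have : ⟪r, p⟫ = 0 := Submodule.inner_left_of_mem_orthogonal hp hr
      simp [inner_add_right, this, hr0]
    refine ⟨-(innerSL ℝ r), h1.le, fun x hx => ?_, Or.inl h1⟩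
    have : ⟪r, x⟫ = 0 := Submodule.inner_left_of_mem_orthogonal (hCU x hx) hr
    simp [this]

/-- Cancellation of a compact summand: if `K + c ⊆ K + C` then `c ∈ C`, even when the convex
cone `C` is not closed. -/
lemma mem_of_forall_add_mem_add (S : Submodule ℝ V) {C : PointedCone ℝ V}
    (hCS : ∀ x ∈ C, x ∈ S) {K : Set V} (hK : IsCompact K) (hne : K.Nonempty) {c : V}
    (h : ∀ k ∈ K, k + c ∈ K + (C : Set V)) : c ∈ C := by
  induction S using WellFoundedLT.induction generalizing C K with
  | ind S ih =>
  by_contra hc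
  obtain ⟨f, hfc, hfC, hf⟩ := exists_separating_functional hc
  obtain ⟨k₀, hk₀, hmin⟩ := hK.exists_isMinOn hne f.continuous.continuousOn
  rw [isMinOn_iff] at hmin
  rcases hfc.lt_or_eq with hlt | heq
  · obtain ⟨k, hk, d, hd, hkd⟩ := h k₀ hk₀
    have h1 := congrArg f hkd
    simp only [map_add] at h1
    have := hfC d hd
    have := hmin k hk
    linarith
  obtain ⟨x, hx, hfx⟩ := hf.resolve_left (by simp [heq])
  have hxS : x ∈ S := Submodule.span_le.2 hCS hx
  -- As `f c = 0`, the hypothesis survives on the face of `K` where `f` is minimal, with only the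
  -- part of `C` in the kernel of `f` used. That part lies in a smaller subspace.
  let C₀ : PointedCone ℝ V := C ⊓ PointedCone.ofSubmodule (LinearMap.ker (f : V →ₗ[ℝ] ℝ))
  have hlt : S ⊓ LinearMap.ker (f : V →ₗ[ℝ] ℝ) < S := by
    refine lt_of_le_of_ne inf_le_left fun h' => hfx ?_
    have := h' ▸ hxS
    exact this.2
  have hc₀ : c ∈ C₀ := by
    refine ih _ hlt (C := C₀) (K := K ∩ {k | f k = f k₀}) (fun y hy => ⟨hCS y hy.1, hy.2⟩)
      (hK.inter_right (isClosed_eq f.continuous continuous_const)) ⟨k₀, hk₀, rfl⟩ ?_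
    rintro k ⟨hk, hkf : f k = f k₀⟩
    obtain ⟨k', hk', d, hd, hkd⟩ := h k hk
    have h1 := congrArg f hkd
    simp only [map_add] at h1
    have h2 := hfC d hd
    have h3 := hmin k' hk'
    exact ⟨k', ⟨hk', show f k' = f k₀ by linarith⟩, d, ⟨hd, show f d = 0 by linarith⟩, hkd⟩
  exact hc hc₀.1

lemma isQuadratic_norm_sq {n : ℕ}
    (P : EuclideanSpace ℝ (Fin n) →ₗ[ℝ] EuclideanSpace ℝ (Fin n)) (y : EuclideanSpace ℝ (Fin n)) :
    IsQuadratic fun x => ‖P (x - y)‖ ^ 2 := by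
  obtain ⟨M, rfl⟩ := Matrix.toEuclideanLin.surjective P
  refine ⟨(2 : ℝ) • (Mᵀ * M), (-2 : ℝ) • (Mᵀ *ᵥ (M *ᵥ y.ofLp)),
    (M *ᵥ y.ofLp) ⬝ᵥ (M *ᵥ y.ofLp), ?_, fun x => ?_⟩
  · simp [Matrix.IsSymm, Matrix.transpose_mul]
  · have h1 : ∀ z : EuclideanSpace ℝ (Fin n), ‖z‖ ^ 2 = z.ofLp ⬝ᵥ z.ofLp := fun z => by
      rw [EuclideanSpace.real_norm_sq_eq]
      simp [dotProduct, sq]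
    have h2 : ∀ u w : Fin n → ℝ, (Mᵀ *ᵥ u) ⬝ᵥ w = u ⬝ᵥ (M *ᵥ w) := fun u w => by
      rw [Matrix.mulVec_transpose, Matrix.dotProduct_mulVec]
    have h3 : x.ofLp ⬝ᵥ ((Mᵀ * M) *ᵥ x.ofLp) = (M *ᵥ x.ofLp) ⬝ᵥ (M *ᵥ x.ofLp) := by
      rw [← Matrix.mulVec_mulVec, dotProduct_comm, h2]
    beta_reduce
    rw [h1, Matrix.ofLp_toLpLin, Matrix.toLin'_apply, WithLp.ofLp_sub, Matrix.mulVec_sub,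
      Matrix.smul_mulVec, dotProduct_smul, h3, smul_dotProduct, h2]
    simp only [dotProduct_sub, sub_dotProduct, smul_eq_mul]
    rw [dotProduct_comm (M *ᵥ y.ofLp) (M *ᵥ x.ofLp)]
    ring

/-- The squared distance from `y` to `x + W` is a nonnegative quadratic in `x`. If `y` is in the
closure of `F + W` its infimum over `F` is `0`, and attainment puts `y` in `F + W`. -/
lemma IsFWSet.isClosed_add_submodule {n : ℕ} {F : Set (EuclideanSpace ℝ (Fin n))}
    (hF : IsFWSet F) (W : Submodule ℝ (EuclideanSpace ℝ (Fin n))) :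
    IsClosed (F + (W : Set (EuclideanSpace ℝ (Fin n)))) := by
  refine isClosed_of_closure_subset fun y hy => ?_
  set P := (Wᗮ).starProjection
  have hPW : ∀ w ∈ W, P w = 0 := fun w hw =>
    (Submodule.starProjection_apply_eq_zero_iff _).2 (by simpa using hw)
  obtain ⟨x, hx, hmin⟩ := hF _ (isQuadratic_norm_sq (P : _ →ₗ[ℝ] _) y)
    ⟨0, by rintro _ ⟨x, -, rfl⟩; positivity⟩
  rw [isMinOn_iff] at hmin
  have hle : ∀ ε > 0, ‖P (x - y)‖ ≤ ε := by
    intro ε hε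
    obtain ⟨_, ⟨a, ha, w, hw, rfl⟩, hd⟩ := Metric.mem_closure_iff.1 hy ε hε
    have h1 : ‖P (x - y)‖ ≤ ‖P (a - y)‖ := by
      have := hmin a ha
      exact (sq_le_sq₀ (norm_nonneg _) (norm_nonneg _)).1 this
    have h2 : P (a - y) = P (a + w - y) := by
      rw [add_sub_right_comm, map_add, hPW w hw, add_zero]
    rw [h2] at h1
    refine h1.trans ((Submodule.norm_starProjection_apply_le _ _).trans ?_)
    rw [dist_comm, dist_eq_norm] at hd
    exact hd.le
  have h0 : P (x - y) = 0 := norm_le_zero_iff.1 (le_of_forall_pos_le_add (by simpa using hle))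
  have : x - y ∈ W := by
    simpa using (Submodule.starProjection_apply_eq_zero_iff _).1 h0
  exact ⟨x, hx, y - x, by simpa using W.neg_mem this, by simp⟩

/-- Every linear image of the recession cone of a nonempty Motzkin FW-set is closed. -/
lemma IsFWSet.isClosed_sup_ofSubmodule {n : ℕ} {K : Set (EuclideanSpace ℝ (Fin n))}
    (hK : IsCompact K) (hne : K.Nonempty) {D : PointedCone ℝ (EuclideanSpace ℝ (Fin n))}
    (hF : IsFWSet (K + (D : Set (EuclideanSpace ℝ (Fin n)))))
    (W : Submodule ℝ (EuclideanSpace ℝ (Fin n))) :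
    IsClosed ((D ⊔ PointedCone.ofSubmodule W : PointedCone ℝ (EuclideanSpace ℝ (Fin n))) :
      Set (EuclideanSpace ℝ (Fin n))) := by
  refine isClosed_of_closure_subset fun c hc => ?_
  refine mem_of_forall_add_mem_add ⊤ (fun _ _ => trivial) hK hne fun k hk => ?_
  have hcl := hF.isClosed_add_submodule W
  rw [add_assoc] at hcl
  have hsub : (D : Set (EuclideanSpace ℝ (Fin n))) + (W : Set (EuclideanSpace ℝ (Fin n))) =
      ((D ⊔ PointedCone.ofSubmodule W : PointedCone ℝ (EuclideanSpace ℝ (Fin n))) :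
        Set (EuclideanSpace ℝ (Fin n))) := (Submodule.coe_sup D (PointedCone.ofSubmodule W)).symm
  rw [hsub] at hcl
  have := map_mem_closure (f := fun x => k + x) (by fun_prop) hc
    (t := K + ((D ⊔ PointedCone.ofSubmodule W : PointedCone ℝ (EuclideanSpace ℝ (Fin n))) :
      Set (EuclideanSpace ℝ (Fin n)))) (fun x hx => Set.add_mem_add hk hx)
  rwa [hcl.closure_eq] at this

end

end FrankWolfe

/-! ### Retractive sets: Motzkin decomposition and attainment -/

namespace FrankWolfe

section

open Filter Topology RealInnerProductSpace


section Retractive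

variable {V : Type*} [NormedAddCommGroup V] [InnerProductSpace ℝ V]

/-- A set is retractive along a cone `D` if every asymptotic direction `v` of a sequence in `S`
belongs to `D`, and the sequence eventually stays in `S` after a step in direction `-v`. -/
def IsRetractive (S : Set V) (D : PointedCone ℝ V) : Prop :=
  ∀ (z : ℕ → V) (v : V), (∀ n, z n ∈ S) → Tendsto (fun n => ‖z n‖) atTop atTop →
    Tendsto (fun n => ‖z n‖⁻¹ • z n) atTop (𝓝 v) → v ∈ D ∧ ∀ᶠ n in atTop, z n - v ∈ S

lemma eventually_norm_sub_lt {z : ℕ → V} {v : V} (hv : ‖v‖ = 1)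
    (hz : Tendsto (fun n => ‖z n‖) atTop atTop)
    (hlim : Tendsto (fun n => ‖z n‖⁻¹ • z n) atTop (𝓝 v)) :
    ∀ᶠ n in atTop, ‖z n - v‖ < ‖z n‖ := by
  have h1 : Tendsto (fun n => ⟪‖z n‖⁻¹ • z n, v⟫) atTop (𝓝 ⟪v, v⟫) := hlim.inner tendsto_const_nhds
  rw [real_inner_self_eq_norm_sq, hv] at h1
  filter_upwards [h1.eventually (lt_mem_nhds (by norm_num : (1 / 2 : ℝ) < 1 ^ 2)),
    hz.eventually_gt_atTop 1] with n h2 h3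
  rw [real_inner_smul_left, inv_mul_eq_div, lt_div_iff₀ (by linarith)] at h2
  refine lt_of_pow_lt_pow_left₀ 2 (norm_nonneg _) ?_
  rw [norm_sub_sq_real, hv]
  linarith

lemma exists_subseq_direction [FiniteDimensional ℝ V] {z : ℕ → V}
    (hz : Tendsto (fun n => ‖z n‖) atTop atTop) :
    ∃ (v : V) (φ : ℕ → ℕ), StrictMono φ ∧ ‖v‖ = 1 ∧
      Tendsto (fun n => ‖z (φ n)‖⁻¹ • z (φ n)) atTop (𝓝 v) := by
  have : ProperSpace V := FiniteDimensional.proper ℝ V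
  obtain ⟨v, hv, φ, hφ, hlim⟩ := (isCompact_sphere (0 : V) 1).tendsto_subseq'
    (x := fun n => ‖z n‖⁻¹ • z n) (Eventually.frequently (by
      filter_upwards [hz.eventually_gt_atTop 0] with n hn
      simp [norm_smul, hn.ne']))
  exact ⟨v, φ, hφ, by simpa using hv, hlim⟩

/-- A sequence in a retractive set that goes to infinity can be shortened at some index by
subtracting a unit vector of the cone. -/
lemma IsRetractive.exists_shorter [FiniteDimensional ℝ V] {S : Set V} {D : PointedCone ℝ V}
    (hS : IsRetractive S D) {z : ℕ → V} (hzS : ∀ n, z n ∈ S)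
    (hz : Tendsto (fun n => ‖z n‖) atTop atTop) :
    ∃ n, ∃ v ∈ D, z n - v ∈ S ∧ ‖z n - v‖ < ‖z n‖ := by
  obtain ⟨v, φ, hφ, hv1, hlim⟩ := exists_subseq_direction hz
  have hz' := hz.comp hφ.tendsto_atTop
  obtain ⟨hvD, hev⟩ := hS (z ∘ φ) v (fun n => hzS _) hz' hlim
  obtain ⟨n, h1, h2⟩ := (hev.and (eventually_norm_sub_lt hv1 hz' hlim)).exists
  exact ⟨φ n, v, hvD, h1, h2⟩

variable [FiniteDimensional ℝ V]

/-- A closed set that is retractive along a closed recession cone has a Motzkin decomposition. -/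
lemma IsRetractive.exists_isCompact_add {S : Set V} {D : PointedCone ℝ V}
    (hS : IsRetractive S D) (hcl : IsClosed S) (hD : IsClosed (D : Set V))
    (hrec : ∀ x ∈ S, ∀ d ∈ D, x + d ∈ S) : ∃ K : Set V, IsCompact K ∧ S = K + (D : Set V) := by
  have : ProperSpace V := FiniteDimensional.proper ℝ V
  obtain ⟨R, hR⟩ : ∃ R : ℕ, ∀ x ∈ S, ∃ d ∈ D, x - d ∈ S ∧ ‖x - d‖ ≤ R := by
    by_contra! H
    choose x hx hH using H
    have hmin : ∀ n, ∃ y ∈ {y | y ∈ S ∧ x n - y ∈ D}, ∀ w ∈ {y | y ∈ S ∧ x n - y ∈ D}, ‖y‖ ≤ ‖w‖ :=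
      fun n => exists_norm_minimal
        (hcl.inter (hD.preimage (by fun_prop : Continuous fun y => x n - y)))
        ⟨x n, hx n, by simp⟩
    choose z hz hzmin using hmin
    have hlarge : ∀ n : ℕ, (n : ℝ) < ‖z n‖ := fun n => by
      simpa using hH n (x n - z n) (hz n).2 (by simpa using (hz n).1)
    obtain ⟨n, v, hvD, h1, h2⟩ := hS.exists_shorter (fun n => (hz n).1)
      (tendsto_atTop_mono (fun n => (hlarge n).le) tendsto_natCast_atTop_atTop)
    refine h2.not_ge (hzmin n _ ⟨h1, ?_⟩)
    have := add_mem (hz n).2 hvD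
    rwa [show x n - (z n - v) = x n - z n + v by abel]
  refine ⟨S ∩ Metric.closedBall 0 R, (isCompact_closedBall _ _).inter_left hcl, ?_⟩
  ext x
  constructor
  · intro hx
    obtain ⟨d, hd, h1, h2⟩ := hR x hx
    exact ⟨x - d, ⟨h1, by simpa using h2⟩, d, hd, by simp⟩
  · rintro ⟨y, ⟨hy, -⟩, d, hd, rfl⟩
    exact hrec y hy d hd

lemma eq_zero_and_nonneg_of_forall_quadratic {p g a : ℝ} (ha : a ≤ 0)
    (h : ∀ t : ℝ, 0 ≤ t → 0 ≤ p + t * g + t ^ 2 * a) : a = 0 ∧ 0 ≤ g := by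
  have ha0 : a = 0 := by
    by_contra hne
    have hlt : 0 < -a := neg_pos.2 (lt_of_le_of_ne ha hne)
    set q := (|p| + |g| + 1) / (-a) with hq
    have hqa : q * a = -(|p| + |g| + 1) := by rw [hq]; field_simp
    have hq0 : 0 ≤ q := by positivity
    have h1 := h (q + 1) (by linarith)
    have h2 : (q + 1) * g ≤ (q + 1) * |g| := by gcongr; exact le_abs_self g
    have h3 : p ≤ (q + 1) * |p| := by nlinarith [le_abs_self p, abs_nonneg p]
    have h4 : (q + 1) ^ 2 * a = (q + 1) * (-(|p| + |g| + 1) + a) := by rw [← hqa]; ring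
    have h5 : (q + 1) * (a - 1) < 0 := mul_neg_of_pos_of_neg (by linarith) (by linarith)
    nlinarith
  refine ⟨ha0, ?_⟩
  by_contra! hg
  have h1 := h ((|p| + 1) / (-g)) (div_nonneg (by positivity) (by linarith))
  have h2 : (|p| + 1) / (-g) * g = -(|p| + 1) := by
    have := hg.ne; field_simp
  rw [ha0, h2] at h1
  linarith [le_abs_self p]

/-- Frank and Wolfe's theorem for closed sets that are retractive along a recession cone. -/
lemma IsRetractive.exists_isMinOn {S : Set V} {D : PointedCone ℝ V} (hS : IsRetractive S D)
    (hcl : IsClosed S) (hrec : ∀ x ∈ S, ∀ d ∈ D, x + d ∈ S) (hne : S.Nonempty)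
    (A : V →L[ℝ] V) (b : V) (c : ℝ) {f : V → ℝ} (hf : ∀ x, f x = ⟪x, A x⟫ + ⟪b, x⟫ + c)
    (hbdd : BddBelow (f '' S)) : ∃ x ∈ S, IsMinOn f S x := by
  have : ProperSpace V := FiniteDimensional.proper ℝ V
  have hfc : Continuous f := by
    rw [funext hf]; fun_prop
  set m := sInf (f '' S)
  have hm : ∀ x ∈ S, m ≤ f x := fun x hx => csInf_le hbdd ⟨x, hx, rfl⟩
  have hmin : ∀ n : ℕ, ∃ y ∈ {y | y ∈ S ∧ f y ≤ m + 1 / ((n : ℝ) + 1)},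
      ∀ w ∈ {y | y ∈ S ∧ f y ≤ m + 1 / ((n : ℝ) + 1)}, ‖y‖ ≤ ‖w‖ := by
    intro n
    refine exists_norm_minimal (hcl.inter (isClosed_le hfc continuous_const)) ?_
    obtain ⟨_, ⟨y, hy, rfl⟩, hlt⟩ := exists_lt_of_csInf_lt (hne.image f)
      (lt_add_of_pos_right m (by positivity : 0 < 1 / ((n : ℝ) + 1)))
    exact ⟨y, hy, hlt.le⟩
  choose z hz hzmin using hmin
  have hlim1 : Tendsto (fun n : ℕ => m + 1 / ((n : ℝ) + 1)) atTop (𝓝 m) := by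
    simpa using tendsto_one_div_add_atTop_nhds_zero_nat.const_add m
  by_cases hunb : Tendsto (fun n => ‖z n‖) atTop atTop
  · exfalso
    obtain ⟨v, φ, hφ, hv1, hlim⟩ := exists_subseq_direction hunb
    have hunb' := hunb.comp hφ.tendsto_atTop
    obtain ⟨hvD, hev⟩ := hS (z ∘ φ) v (fun n => (hz _).1) hunb' hlim
    have hexp : ∀ (x : V) (t : ℝ), f (x + t • v) =
        f x + t * (⟪x, A v⟫ + ⟪v, A x⟫ + ⟪b, v⟫) + t ^ 2 * ⟪v, A v⟫ := by
      intro x t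
      rw [hf, hf]
      simp only [map_add, map_smul, inner_add_left, inner_add_right, real_inner_smul_left,
        real_inner_smul_right]
      ring
    -- Divide `f (z (φ n)) ≤ m + 1` by `‖z (φ n)‖ ^ 2` and pass to the limit.
    have hvA : ⟪v, A v⟫ ≤ 0 := by
      have hinv : Tendsto (fun n => ‖z (φ n)‖⁻¹) atTop (𝓝 0) := hunb'.inv_tendsto_atTop
      have hl : Tendsto (fun n => ⟪‖z (φ n)‖⁻¹ • z (φ n), A (‖z (φ n)‖⁻¹ • z (φ n))⟫ +
          ‖z (φ n)‖⁻¹ * ⟪b, ‖z (φ n)‖⁻¹ • z (φ n)⟫) atTop (𝓝 (⟪v, A v⟫ + 0 * ⟪b, v⟫)) :=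
        (hlim.inner ((A.continuous.tendsto v).comp hlim)).add
          (hinv.mul (tendsto_const_nhds.inner hlim))
      have hr : Tendsto (fun n => (‖z (φ n)‖⁻¹) ^ 2 * (m + 1 - c)) atTop
          (𝓝 (0 ^ 2 * (m + 1 - c))) := (hinv.pow 2).mul_const _
      have := le_of_tendsto_of_tendsto' hl hr fun n => by
        have h1 : f (z (φ n)) ≤ m + 1 := by
          refine (hz (φ n)).2.trans ?_
          gcongr
          rw [div_le_one (by positivity)]
          linarith [(φ n).cast_nonneg (α := ℝ)]
        rw [hf] at h1
        simp only [map_smul, real_inner_smul_left, real_inner_smul_right]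
        nlinarith [mul_le_mul_of_nonneg_left h1 (sq_nonneg (‖z (φ n)‖⁻¹))]
      simpa using this
    -- `f` is bounded below on the ray from `x` along `v`, so its curvature vanishes and its slope
    -- is nonnegative: stepping back by `v` does not increase `f`.
    have hdir : ∀ x ∈ S, ⟪v, A v⟫ = 0 ∧ 0 ≤ ⟪x, A v⟫ + ⟪v, A x⟫ + ⟪b, v⟫ := fun x hx =>
      eq_zero_and_nonneg_of_forall_quadratic (p := f x - m) hvA fun t ht => by
        have := hm _ (hrec x hx (t • v) (D.smul_mem ht hvD))
        rw [hexp] at this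
        linarith
    obtain ⟨n, h1, h2⟩ := (hev.and (eventually_norm_sub_lt hv1 hunb' hlim)).exists
    refine h2.not_ge (hzmin (φ n) _ ⟨h1, le_trans ?_ (hz (φ n)).2⟩)
    obtain ⟨h3, h4⟩ := hdir _ (hz (φ n)).1
    have := hexp (z (φ n)) (-1)
    rw [neg_one_smul, ← sub_eq_add_neg] at this
    rw [this, h3]
    linarith
  · obtain ⟨R, hR⟩ : ∃ R : ℝ, ∃ᶠ n in atTop, ‖z n‖ ≤ R := by
      by_contra! H
      refine hunb (tendsto_atTop.2 fun R => ?_)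
      filter_upwards [H R] with n hn
      exact hn.le
    obtain ⟨x, -, φ, hφ, hlim⟩ := (isCompact_closedBall (0 : V) R).tendsto_subseq' (x := z)
      (hR.mono fun n hn => by simpa using hn)
    have hx : x ∈ S := hcl.mem_of_tendsto hlim (Eventually.of_forall fun n => (hz _).1)
    have hfx : f x ≤ m := le_of_tendsto_of_tendsto' ((hfc.tendsto x).comp hlim)
      (hlim1.comp hφ.tendsto_atTop) fun n => (hz _).2
    exact ⟨x, hx, isMinOn_iff.2 fun y hy => hfx.trans (hm y hy)⟩

end Retractive

lemma IsQuadratic.exists_continuousLinearMap {n : ℕ} {f : EuclideanSpace ℝ (Fin n) → ℝ}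
    (hf : IsQuadratic f) : ∃ (A : EuclideanSpace ℝ (Fin n) →L[ℝ] EuclideanSpace ℝ (Fin n))
      (b : EuclideanSpace ℝ (Fin n)) (c : ℝ), ∀ x, f x = ⟪x, A x⟫ + ⟪b, x⟫ + c := by
  obtain ⟨A, b, c, -, h⟩ := hf
  refine ⟨(1 / 2 : ℝ) • (Matrix.toEuclideanLin A).toContinuousLinearMap, WithLp.toLp 2 b, c,
    fun x => ?_⟩
  rw [h x]
  simp [EuclideanSpace.inner_eq_star_dotProduct, dotProduct_comm]

/-! ### Affine preimages -/

section Preimage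

variable {V W : Type*} [NormedAddCommGroup V] [InnerProductSpace ℝ V] [NormedAddCommGroup W]
  [InnerProductSpace ℝ W]

/-- Preimages of `K + D` under affine maps `x ↦ L x + w` are retractive if the cone `D` is
polyhedral near each of its points. -/
lemma isRetractive_preimage_add {K : Set W} {D : ProperCone ℝ W} (hK : IsCompact K)
    (hD : ∀ v ∈ D, ∃ δ > 0, ∀ w ∈ D, ‖w - v‖ < δ → w - (1 / 2 : ℝ) • v ∈ D)
    (L : V →L[ℝ] W) (w₀ : W) :
    IsRetractive {x | L x + w₀ ∈ K + (D : Set W)} (D.comap L : PointedCone ℝ V) := by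
  intro z v hz hunb hlim
  choose k hk d hd hkd using hz
  have hinv : Tendsto (fun n => ‖z n‖⁻¹) atTop (𝓝 0) := hunb.inv_tendsto_atTop
  have hbd : Tendsto (fun n => ‖z n‖⁻¹ • (w₀ - k n)) atTop (𝓝 0) := by
    obtain ⟨R, hR⟩ := hK.isBounded.exists_norm_le
    refine squeeze_zero_norm (a := fun n => ‖z n‖⁻¹ * (‖w₀‖ + R)) (fun n => ?_)
      (by simpa using hinv.mul_const (‖w₀‖ + R))
    rw [norm_smul, norm_inv, norm_norm]
    gcongr
    exact (norm_sub_le _ _).trans (by gcongr; exact hR _ (hk n))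
  have hdlim : Tendsto (fun n => ‖z n‖⁻¹ • d n) atTop (𝓝 (L v)) := by
    have := ((L.continuous.tendsto v).comp hlim).add hbd
    rw [add_zero] at this
    refine this.congr fun n => ?_
    have h1 : d n = L (z n) + (w₀ - k n) := by
      have := hkd n
      simp only at this
      rw [← add_sub_assoc, ← this]; abel
    rw [h1, smul_add, Function.comp_apply, map_smul]
  have hLv : L v ∈ D := D.isClosed.mem_of_tendsto hdlim
    (Eventually.of_forall fun n => D.smul_mem (hd n) (inv_nonneg.2 (norm_nonneg _)))
  refine ⟨hLv, ?_⟩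
  obtain ⟨δ, hδ, hnear⟩ := hD _ hLv
  -- The bound `2` makes the coefficient `‖z n‖ / 2 - 1` of `L v` nonnegative once the half-step is
  -- rescaled by `‖z n‖`.
  filter_upwards [hdlim.eventually (Metric.ball_mem_nhds _ hδ), hunb.eventually_ge_atTop 2]
    with n h1 h2
  have h3 := hnear _ (D.smul_mem (hd n) (inv_nonneg.2 (norm_nonneg (z n))))
    (by simpa [dist_eq_norm] using h1)
  have h4 := add_mem (D.smul_mem h3 (norm_nonneg (z n)))
    (D.smul_mem hLv (by linarith : 0 ≤ ‖z n‖ / 2 - 1))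
  have h5 : ‖z n‖ • (‖z n‖⁻¹ • d n - (1 / 2 : ℝ) • L v) + (‖z n‖ / 2 - 1) • L v = d n - L v := by
    rw [smul_sub, smul_inv_smul₀ (by linarith)]; module
  rw [h5] at h4
  refine ⟨k n, hk n, d n - L v, h4, ?_⟩
  have := hkd n
  simp only at this ⊢
  rw [← add_sub_assoc, this, map_sub]; abel

end Preimage

end

end FrankWolfe

theorem mainTheorem7 (n m : ℕ)
    (T : EuclideanSpace ℝ (Fin n) →ᵃ[ℝ] EuclideanSpace ℝ (Fin m))
    (F : Set (EuclideanSpace ℝ (Fin m))) (hF : FrankWolfe.IsFWMSet F)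
    (hne : (T ⁻¹' F).Nonempty) :
    FrankWolfe.IsFWMSet (T ⁻¹' F) := by
  obtain ⟨⟨hcl, K, D, hK, rfl⟩, hFW⟩ := hF
  have hKne : K.Nonempty := by
    obtain ⟨x, k, hk, -⟩ := hne
    exact ⟨k, hk⟩
  have hcl' := hcl.preimage T.continuous_of_finiteDimensional
  let L := T.linear.toContinuousLinearMap
  have hT : ∀ x, T x = L x + T 0 := fun x => congrFun T.decomp x
  have hpre : T ⁻¹' (K + (D : Set (EuclideanSpace ℝ (Fin m)))) =
      {x | L x + T 0 ∈ K + (D : Set (EuclideanSpace ℝ (Fin m)))} := by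
    ext x
    simp only [Set.mem_preimage, Set.mem_ofPred_eq, hT x]
  have hloc : ∀ v ∈ D, ∃ δ > 0, ∀ w ∈ D, ‖w - v‖ < δ → w - (1 / 2 : ℝ) • v ∈ D := fun v hv =>
    FrankWolfe.exists_forall_sub_half_mem (C := (D : PointedCone ℝ (EuclideanSpace ℝ (Fin m))))
      (FrankWolfe.IsFWSet.isClosed_sup_ofSubmodule hK hKne hFW) hv
  have hret := FrankWolfe.isRetractive_preimage_add hK hloc L (T 0)
  rw [← hpre] at hret
  have hrec : ∀ x ∈ T ⁻¹' (K + (D : Set (EuclideanSpace ℝ (Fin m)))),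
      ∀ d ∈ (D.comap L : PointedCone ℝ (EuclideanSpace ℝ (Fin n))),
        x + d ∈ T ⁻¹' (K + (D : Set (EuclideanSpace ℝ (Fin m)))) := by
    rintro x ⟨k, hk, e, he, hx⟩ d hd
    refine ⟨k, hk, e + L d, add_mem he hd, ?_⟩
    simp only at hx ⊢
    rw [← add_assoc, hx, hT x, hT (x + d), map_add]; abel
  refine ⟨⟨hcl', ?_⟩, fun f hf hbdd => ?_⟩
  · obtain ⟨K', hK', h⟩ := hret.exists_isCompact_add hcl' (D.comap L).isClosed hrec
    exact ⟨K', D.comap L, hK', h⟩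
  · obtain ⟨A, b, c, hA⟩ := hf.exists_continuousLinearMap
    exact hret.exists_isMinOn hcl' hrec hne A b c hA hbdd
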